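/- Let $V$ be a finite dimensional complex vector space, $\Lambda\subset V$ a lattice of full rank, $T:=V/\Lambda$, and let $\tau:V\to V$ be an antilinear involution with $\tau(\Lambda)\subset\Lambda$; denote the induced involution of $T$ also by $\tau$. Write $\Lambda^{\pm\tau}:=\{\lambda\in\Lambda:\tau\lambda=\pm\lambda\}$ and $V^\tau:=\{v\in V:\tau v=v\}$; recall that the components of the fixed point locus $T^\tau$ are the translates $V^\tau/\Lambda^\tau+[\mu]$ with $[\mu]\in\frac12\Lambda^{-\tau}/\frac12(1-\tau)\Lambda$, each with fundamental group $\Lambda^\tau$. Let $(H,\alpha)$ be an Appell–Humbert datum: $H$ is a Hermitian form on $V$, antilinear in the first and linear in the second variable, with $\operatorname{im}H(\Lambda\times\Lambda)\subset\mathbb Z$, and $\alpha:\Lambda\to S^1$ satisfies $\alpha(\lambda+\lambda')=\alpha(\lambda)\alpha(\lambda')e^{\pi i\,\operatorname{im}H(\lambda,\lambda')}$. Let $\mathcal L=\mathcal L(H,\alpha)$ be the holomorphic line bundle on $T$ obtained from $V\times\mathbb C$ by identifying $(v,z)$ with $\big(v+\lambda,\ \alpha(\lambda)e^{\pi[H(\lambda,v)+\frac12H(\lambda,\lambda)]}z\big)$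 for all $\lambda\in\Lambda$. Suppose that $\tau^*\overline{\mathcal L}\simeq\mathcal L$ as holomorphic line bundles. Then $\tau$ has involutive antiholomorphic, fibrewise antilinear lifts $\tilde\tau:\mathcal L\to\mathcal L$, and the first Stiefel–Whitney class $w(\mathcal L):=w_1(\mathcal L^{\tilde\tau})$ of the real line bundle $\mathcal L^{\tilde\tau}$ of fixed points over $T^\tau$ does not depend on the choice of $\tilde\tau$. Evaluation on the loops in $T^\tau$ makes $w(\mathcal L)$ a well defined map $$w(\mathcal L):\tfrac12\Lambda^{-\tau}/\tfrac12(1-\tau)\Lambda\longrightarrow\operatorname{Hom}(\Lambda^\tau,\mathbb Z/2).$$ This map satisfies: (1) $w(\mathcal L)([\mu])=w(\mathcal L)([0])+\big(\operatorname{im}H(2\mu,\cdot)\bmod 2\big)$ for every $\mu\in\frac12\Lambda^{-\tau}$; (2) $w(\mathcal L)([\mu])(\lambda+\tau\lambda)=\operatorname{im}H(\lambda,\tau\lambda)\bmod 2$ for every $\mu\in\frac12\Lambda^{-\tau}$ and every $\lambda\in\Lambda$; (3) $(-1)^{w(\mathcal L)([0])(\lambda)}=\overline{\alpha(\lambda)}$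 (complex conjugate) for every $\lambda\in\Lambda^\tau$. -/

import Mathlib

open Complex Topology
open scoped ComplexConjugate

noncomputable section

/-- A map between complex normed spaces is antiholomorphic near `x` if at all points near `x` it is
real differentiable with complex antilinear derivative. -/
def AntiholomorphicNear {E G : Type*} [NormedAddCommGroup E] [NormedSpace ℂ E]
    [NormedAddCommGroup G] [NormedSpace ℂ G] (f : E → G) (x : E) : Prop :=
  ∀ᶠ y in 𝓝 x, ∃ f' : E →L[ℝ] G, HasFDerivAt f f' y ∧ ∀ v : E, f' (I • v) = -(I • f' v)

/-- The value on the loop `γ` of the first Stiefel-Whitney class of a real line bundle with total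
space `E`, base `X`, projection `p` and zero section `z`: it is `0` if the pull-back of the bundle
to the circle along `γ` has a nowhere vanishing continuous section (that is, if this pull-back is
trivial), and `1` otherwise. -/
def stiefelWhitneyOne {X E : Type*} [TopologicalSpace X] [TopologicalSpace E]
    (p : E → X) (z : X → E) (γ : C(UnitAddCircle, X)) : ZMod 2 :=
  open Classical in
  if ∃ s : C(UnitAddCircle, E), ∀ t, p (s t) = γ t ∧ s t ≠ z (γ t) then 0 else 1

variable {V : Type*} [NormedAddCommGroup V] [NormedSpace ℂ V]

/-- An antilinear involution of `V` which maps `Λ` into `Λ`. -/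
structure LatticeInvolution (Λ : Submodule ℤ V) where
  /-- the underlying antilinear map -/
  toMap : V →ₛₗ[starRingEnd ℂ] V
  involutive : ∀ v, toMap (toMap v) = v
  mapsLattice : ∀ l ∈ Λ, toMap l ∈ Λ

/-- An Appell-Humbert datum `(H, α)`; the Hermitian form `H` is antilinear in the first and linear
in the second variable. -/
structure AHDatum (Λ : Submodule ℤ V) where
  /-- the Hermitian form -/
  H : V →ₗ⋆[ℂ] V →ₗ[ℂ] ℂ
  hermitian : ∀ v w, H w v = conj (H v w)
  integral : ∀ l m : Λ, ∃ n : ℤ, (n : ℝ) = (H l m).im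
  /-- the semi-character -/
  α : Λ → Circle
  semichar : ∀ l m : Λ,
    (α (l + m) : ℂ) = α l * α m * exp (Real.pi * I * ((H l m).im : ℂ))

namespace LatticeInvolution

variable {Λ : Submodule ℤ V} (τ : LatticeInvolution Λ)

/-- The involution of the torus `V / Λ` induced by `τ`. -/
def torusMap : V ⧸ Λ → V ⧸ Λ :=
  Submodule.mapQ Λ Λ τ.toMap.toAddMonoidHom.toIntLinearMap (fun l hl => τ.mapsLattice l hl)

/-- The fixed point locus of the induced involution of the torus. -/
def FixedLocus : Type _ := {x : V ⧸ Λ // τ.torusMap x = x}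

instance : TopologicalSpace τ.FixedLocus :=
  inferInstanceAs (TopologicalSpace {x : V ⧸ Λ // τ.torusMap x = x})

/-- The group of `τ`-invariant lattice vectors. -/
def fixedLattice : AddSubgroup V where
  carrier := {l | l ∈ Λ ∧ τ.toMap l = l}
  zero_mem' := ⟨Λ.zero_mem, map_zero _⟩
  add_mem' := fun ha hb => ⟨Λ.add_mem ha.1 hb.1, by rw [map_add, ha.2, hb.2]⟩
  neg_mem' := fun ha => ⟨Λ.neg_mem ha.1, by rw [map_neg, ha.2]⟩

/-- The group of all `μ` such that `2μ` is a lattice vector with `τ(2μ) = -2μ`. -/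
def halfAntiLattice : AddSubgroup V where
  carrier := {m | (2 : ℤ) • m ∈ Λ ∧ τ.toMap ((2 : ℤ) • m) = -((2 : ℤ) • m)}
  zero_mem' := by simp
  add_mem' := fun ha hb => ⟨by rw [smul_add]; exact Λ.add_mem ha.1 hb.1,
    by rw [smul_add, map_add, ha.2, hb.2, neg_add]⟩
  neg_mem' := fun ha => ⟨by rw [smul_neg]; exact Λ.neg_mem ha.1,
    by rw [smul_neg, map_neg, ha.2]⟩

/-- The group of all vectors `(λ - τλ)/2` with `λ` in the lattice. -/
def halfDifferences : AddSubgroup V where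
  carrier := {m | ∃ l ∈ Λ, m = (1 / 2 : ℂ) • (l - τ.toMap l)}
  zero_mem' := ⟨0, Λ.zero_mem, by simp⟩
  add_mem' := by
    rintro _ _ ⟨a, ha, rfl⟩ ⟨b, hb, rfl⟩
    exact ⟨a + b, Λ.add_mem ha hb, by rw [map_add, ← smul_add, add_sub_add_comm]⟩
  neg_mem' := by
    rintro _ ⟨a, ha, rfl⟩
    exact ⟨-a, Λ.neg_mem ha, by rw [map_neg, ← smul_neg]; congr 1; abel⟩

/-- The group of components of the fixed point locus. -/
abbrev ComponentGroup : Type _ :=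
  τ.halfAntiLattice ⧸ τ.halfDifferences.addSubgroupOf τ.halfAntiLattice

/-- The vector `2μ` as a lattice vector. -/
def double (m : τ.halfAntiLattice) : Λ := ⟨(2 : ℤ) • (m : V), m.2.1⟩

/-- The lattice vector `τλ`. -/
def latticeMap (l : Λ) : Λ := ⟨τ.toMap l, τ.mapsLattice l l.2⟩

/-- The invariant lattice vector `λ + τλ`. -/
def trace (l : Λ) : τ.fixedLattice :=
  ⟨l + τ.toMap l, Λ.add_mem l.2 (τ.mapsLattice l l.2),
    by rw [map_add, τ.involutive, add_comm]⟩

/-- The inclusion of the invariant lattice vectors in the lattice. -/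
def inclusion : τ.fixedLattice →+ Λ where
  toFun l := ⟨l, l.2.1⟩
  map_zero' := rfl
  map_add' _ _ := rfl

/-- The loop `γ` in the fixed point locus lies in the component `V^τ/Λ^τ + [μ]`, and its class in
the fundamental group `Λ^τ` of this component is `λ`: it lifts to a path in `V^τ + μ` whose end
point is its starting point plus `λ`. -/
def Represents (γ : C(UnitAddCircle, τ.FixedLocus)) (m : τ.halfAntiLattice)
    (l : τ.fixedLattice) : Prop :=
  ∃ δ : C(unitInterval, V), (∀ t, τ.toMap (δ t - m) = δ t - m) ∧ δ 1 = δ 0 + l ∧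
    ∀ t : unitInterval, (γ ((t : ℝ) : UnitAddCircle)).1 = Submodule.Quotient.mk (δ t)

end LatticeInvolution

namespace AHDatum

variable {Λ : Submodule ℤ V} (D : AHDatum Λ)

/-- The integer `im H(λ, λ')`. -/
def imH (l m : Λ) : ℤ := (D.integral l m).choose

theorem cast_imH (l m : Λ) : (D.imH l m : ℝ) = (D.H l m).im := (D.integral l m).choose_spec

/-- The homomorphism `im H(λ, ·)` mod 2. -/
def imHModTwo (l : Λ) : Λ →+ ZMod 2 :=
  AddMonoidHom.mk' (fun m => ((D.imH l m : ℤ) : ZMod 2)) (by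
    intro a b
    have : D.imH l (a + b) = D.imH l a + D.imH l b := by
      have h : (D.imH l (a + b) : ℝ) = D.imH l a + D.imH l b := by
        simp [cast_imH]
      exact_mod_cast h
    simp [this])

/-- The canonical factor of automorphy. -/
def factor (l : Λ) (v : V) : ℂ :=
  D.α l * exp (Real.pi * (D.H l v + 1 / 2 * D.H l l))

theorem factor_add (l m : Λ) (v : V) :
    D.factor (l + m) v = D.factor l (v + m) * D.factor m v := by
  have h1 : (D.H l m) + conj (D.H l m) + 2 * I * ((D.H l m).im : ℂ) = 2 * D.H l m := by
    apply Complex.ext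
    · simp; ring
    · simp
  simp only [factor, D.semichar]
  rw [mul_mul_mul_comm, ← exp_add, mul_assoc, ← exp_add]
  congr 2
  simp only [Submodule.coe_add, map_add, LinearMap.add_apply, D.hermitian l m]
  linear_combination (Real.pi / 2 : ℂ) * h1

theorem factor_zero (v : V) : D.factor 0 v = 1 := by
  have h := D.semichar 0 0
  simp only [add_zero, Submodule.coe_zero, map_zero, Complex.zero_im, Complex.ofReal_zero,
    mul_zero, Complex.exp_zero, mul_one] at h
  have h0 : (D.α 0 : ℂ) ≠ 0 := Circle.coe_ne_zero _
  have h1 : (D.α 0 : ℂ) = 1 := by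
    apply mul_left_cancel₀ h0
    rw [mul_one]; exact h.symm
  simp [factor, h1]

/-- The equivalence relation on `V × ℂ` defined by the factor of automorphy. -/
def setoid : Setoid (V × ℂ) where
  r p q := ∃ l : Λ, q.1 = p.1 + l ∧ q.2 = D.factor l p.1 * p.2
  iseqv := by
    refine ⟨fun p => ⟨0, by simp, by simp [factor_zero]⟩, ?_, ?_⟩
    · rintro ⟨v, x⟩ ⟨w, y⟩ ⟨l, h1, h2⟩
      simp only at h1 h2
      refine ⟨-l, by simp [h1], ?_⟩
      have h := D.factor_add (-l) l v
      rw [neg_add_cancel, factor_zero] at h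
      simp only [h1, h2]
      rw [← mul_assoc, ← h, one_mul]
    · rintro ⟨v, x⟩ ⟨w, y⟩ ⟨u, z⟩ ⟨l, h1, h2⟩ ⟨m, h3, h4⟩
      simp only at h1 h2 h3 h4
      refine ⟨m + l, ?_, ?_⟩
      · simp only [h3, h1, Submodule.coe_add]; abel
      · simp only [h4, h2, factor_add, h1]; ring

/-- The total space of the holomorphic line bundle `L(H, α)`. -/
def LineBundle : Type _ := Quotient D.setoid

/-- The quotient map from `V × ℂ`; it is a covering map, and the charts of the complex
manifold `L(H, α)` are its local inverses. -/
def toBundle (p : V × ℂ) : D.LineBundle := Quotient.mk D.setoid p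

instance : TopologicalSpace D.LineBundle :=
  inferInstanceAs (TopologicalSpace (Quotient D.setoid))

/-- The bundle projection onto the torus. -/
def proj : D.LineBundle → V ⧸ Λ :=
  Quotient.lift (fun p => Submodule.Quotient.mk p.1) (by
    rintro p q ⟨l, h, -⟩
    rw [eq_comm, Submodule.Quotient.eq, h]
    simp)

/-- Multiplication by scalars in the fibres. -/
instance : SMul ℂ D.LineBundle where
  smul c := Quotient.map (fun p => (p.1, c * p.2)) (by
    rintro p q ⟨l, h1, h2⟩
    exact ⟨l, h1, by simp only [h2]; ring⟩)

/-- The zero section. -/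
def zeroSection : V ⧸ Λ → D.LineBundle :=
  Quotient.lift (fun v => D.toBundle (v, 0)) (by
    intro v w h
    refine Quotient.sound ⟨⟨w - v, ?_⟩, by simp, by simp⟩
    rw [← neg_sub]
    exact Λ.neg_mem ((Submodule.quotientRel_def Λ).1 h))

/-- Antiholomorphic self-maps of the complex manifold `L(H, α)`: in the charts given by local
inverses of the quotient map, the map is antiholomorphic. -/
def IsAntiholomorphic (F : D.LineBundle → D.LineBundle) : Prop :=
  ∀ p q : V × ℂ, F (D.toBundle p) = D.toBundle q → ∃ f : V × ℂ → V × ℂ,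
    f p = q ∧ AntiholomorphicNear f p ∧ ∀ᶠ x in 𝓝 p, F (D.toBundle x) = D.toBundle (f x)

/-- `F` is an antiholomorphic lift of `τ` which is antilinear on the fibres. (The fibres have
complex dimension one, so that compatibility with scalars is antilinearity.) -/
structure IsAntiLift (τ : LatticeInvolution Λ) (F : D.LineBundle → D.LineBundle) : Prop where
  proj_map : ∀ p, D.proj (F p) = τ.torusMap (D.proj p)
  map_smul : ∀ (c : ℂ) p, F (c • p) = conj c • F p
  antiholomorphic : D.IsAntiholomorphic F

/-- The total space of the line bundle `τ^* L̄` over the torus, for `L = L(H, α)`: the fibre over `x`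
is the fibre of `L` over `τ x`, in which a scalar `c` acts as its conjugate does in `L`, and the
complex structure is the one for which `(x, p) ↦ p` is an antiholomorphic diffeomorphism onto `L`. -/
def ConjPullback (τ : LatticeInvolution Λ) : Type _ :=
  {q : (V ⧸ Λ) × D.LineBundle // D.proj q.2 = τ.torusMap q.1}

/-- The class of `L = L(H, α)` in the Picard group is invariant under `[L] ↦ [τ^* L̄]`: there is an
isomorphism of holomorphic line bundles from `L` to `τ^* L̄`, that is, a bijection of the total
spaces over the identity of the torus which is complex linear on the fibres and holomorphic. -/
def IsInvariant (τ : LatticeInvolution Λ) : Prop :=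
  ∃ Φ : D.LineBundle ≃ D.ConjPullback τ,
    (∀ p, (Φ p).1.1 = D.proj p) ∧
    (∀ (c : ℂ) p, (Φ (c • p)).1.2 = conj c • (Φ p).1.2) ∧
    D.IsAntiholomorphic (fun p => (Φ p).1.2)

/-- `F` is an involutive antiholomorphic lift of `τ` to `L(H, α)`. -/
structure IsRealLift (τ : LatticeInvolution Λ) (F : D.LineBundle → D.LineBundle) : Prop
    extends D.IsAntiLift τ F where
  involutive : Function.Involutive F

variable {D}

/-- The total space of the real line bundle of fixed points of a lift of `τ`. -/
def FixedBundle (F : D.LineBundle → D.LineBundle) : Type _ := {p : D.LineBundle // F p = p}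

instance (F : D.LineBundle → D.LineBundle) : TopologicalSpace (FixedBundle F) :=
  inferInstanceAs (TopologicalSpace {p : D.LineBundle // F p = p})

/-- The projection of the bundle of fixed points onto the fixed point locus of the torus. -/
def fixedProj {τ : LatticeInvolution Λ} {F : D.LineBundle → D.LineBundle}
    (hF : D.IsRealLift τ F) (p : FixedBundle F) : τ.FixedLocus :=
  ⟨D.proj p.1, by rw [← hF.proj_map, p.2]⟩

theorem map_zeroSection {τ : LatticeInvolution Λ} {F : D.LineBundle → D.LineBundle}
    (hF : D.IsRealLift τ F) (x : V ⧸ Λ) :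
    F (D.zeroSection x) = D.zeroSection (τ.torusMap x) := by
  have key : ∀ p : D.LineBundle, (0 : ℂ) • p = D.zeroSection (D.proj p) := by
    rintro ⟨p⟩
    change D.toBundle (p.1, 0 * p.2) = D.toBundle (p.1, 0)
    rw [zero_mul]
  have hp : ∀ x, D.proj (D.zeroSection x) = x := by rintro ⟨v⟩; rfl
  have h := hF.map_smul 0 (D.zeroSection x)
  rwa [map_zero, key, key, hF.proj_map, hp] at h

/-- The zero section of the bundle of fixed points. -/
def fixedZero {τ : LatticeInvolution Λ} {F : D.LineBundle → D.LineBundle}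
    (hF : D.IsRealLift τ F) (x : τ.FixedLocus) : FixedBundle F :=
  ⟨D.zeroSection x.1, by rw [map_zeroSection hF, x.2]⟩

variable (D)

/-- `w` is the class `w(L)` of `L = L(H, α)`, regarded as a map from the group of components of the
fixed point locus of the torus to `Hom(Λ^τ, ℤ/2)`: there are involutive antiholomorphic lifts `F`
of `τ`, and for each of them the first Stiefel-Whitney class of the bundle of fixed points of `F`
takes the value `w [μ] λ` on all loops of class `λ` in the component of `[μ]`. -/
def IsStiefelWhitneyMap (τ : LatticeInvolution Λ)
    (w : τ.ComponentGroup → (τ.fixedLattice →+ ZMod 2)) : Prop :=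
  (∃ F, D.IsRealLift τ F) ∧
  ∀ (F : D.LineBundle → D.LineBundle) (hF : D.IsRealLift τ F) (m : τ.halfAntiLattice)
    (l : τ.fixedLattice) (γ : C(UnitAddCircle, τ.FixedLocus)), τ.Represents γ m l →
    stiefelWhitneyOne (fixedProj hF) (fixedZero hF) γ = w (QuotientAddGroup.mk m) l

end AHDatum

end

/-!
The isomorphism of `L` with `τ^* L̄` is an antiholomorphic lift of `τ`, that is, a map
`[v, z] ↦ [τ v, conj z * g v]` with `conj ∘ g` entire and nowhere zero. Compatibility with the
factor of automorphy makes `|g v| exp (-π/2 (H (τ v) (τ v) - H v v))` periodic, hence bounded above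
and below. Liouville's theorem on complex lines then gives `H (τ v) (τ v) = H v v`, so
`H (τ v) (τ w) = conj (H v w)` by polarization; once this is known, `g` is bounded, hence constant,
and `α (τ l) = conj (α l)` (`IsAntiLift.isReal_and_const`). Conversely these symmetries make
`[v, z] ↦ [τ v, conj z]` a real lift, and every real lift is of the form
`[v, z] ↦ [τ v, c * conj z]` with `|c| = 1`.

For such a lift, the fixed vectors over `m + w`, with `τ m = -m` and `τ w = w`, are the real
multiples of `[m + w, s * exp (π H(m, w))]`, where `s ^ 2 = c * conj (α (-2m))`
(`IsRealLift.exists_frame`). Along a path from `w` to `w + l` this frame returns to itself up to a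
positive factor and the sign `α l * (-1) ^ im H(2m, l)` (`IsReal.exists_factor_mul`), which does not
involve `c`. If the sign is `1`, rescaling the frame gives a section over the loop. If it is `-1`,
the coordinate of a nowhere vanishing section would be a continuous real function that changes sign
without a zero; continuity of the coordinate uses that the quotient map onto `L` is open and that
`Λ` is discrete. So the Stiefel-Whitney map is `l ↦ a l + im H(2m, l)` with `(-1) ^ a l = α l`, and
the three formulas are short computations with the symmetries of `H` and `α`.
-/

/-! ### Entire functions of quadratic growth -/

section Analysis

variable {V : Type*} [NormedAddCommGroup V] [NormedSpace ℂ V]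

/-- On the line through `v` the function would be bounded and tend to `0`, hence vanish, by
Liouville's theorem. -/
theorem not_neg_of_norm_le_exp {h : V → ℂ} (hd : Differentiable ℂ h) (h0 : ∀ v, h v ≠ 0)
    {q : V → ℝ} (hq : ∀ (z : ℂ) v, q (z • v) = ‖z‖ ^ 2 * q v) {C : ℝ}
    (hb : ∀ v, ‖h v‖ ≤ C * Real.exp (q v)) (v : V) : ¬ q v < 0 := by
  intro hv
  have hC : 0 ≤ C := by
    by_contra hC
    have := (norm_nonneg _).trans (hb v)
    exact absurd this (not_le.2 (mul_neg_of_neg_of_pos (not_le.1 hC) (Real.exp_pos _)))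
  have hb' : ∀ z : ℂ, ‖h (z • v)‖ ≤ C * Real.exp (‖z‖ ^ 2 * q v) := fun z => hq z v ▸ hb _
  have hconst : ∀ z : ℂ, h (z • v) = h 0 := by
    intro z
    have hd' : Differentiable ℂ fun z : ℂ => h (z • v) :=
      hd.comp (differentiable_id.smul_const v)
    have := hd'.apply_eq_apply_of_bounded (isBounded_iff_forall_norm_le.2 ⟨C, ?_⟩) z 0
    · simpa using this
    · rintro _ ⟨z, rfl⟩
      refine (hb' z).trans (mul_le_of_le_one_right hC (Real.exp_le_one_iff.2 ?_))
      exact mul_nonpos_of_nonneg_of_nonpos (by positivity) hv.le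
  have hlim : Filter.Tendsto (fun n : ℕ => C * Real.exp ((n : ℝ) ^ 2 * q v)) Filter.atTop
      (𝓝 (C * 0)) := by
    refine (Real.tendsto_exp_atBot.comp ?_).const_mul C
    refine Filter.Tendsto.atTop_mul_const_of_neg hv ?_
    exact (Filter.tendsto_pow_atTop two_ne_zero).comp tendsto_natCast_atTop_atTop
  have hle : ‖h 0‖ ≤ C * 0 := ge_of_tendsto' hlim fun n => by
    have := hb' (n : ℂ)
    rwa [hconst, Complex.norm_natCast] at this
  exact h0 0 (norm_le_zero_iff.1 (by simpa using hle))

/-- If `|h| exp (-q)` is periodic with respect to a lattice and `q` is homogeneous of degree two,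
then `q` vanishes and the entire function `h` is constant: `|h| exp (-q)` is bounded above and
below, so that growth excludes both signs of `q`. -/
theorem eq_zero_and_const_of_periodic [FiniteDimensional ℂ V] (Λ : Submodule ℤ V)
    [DiscreteTopology Λ] [IsZLattice ℝ Λ] {h : V → ℂ} (hd : Differentiable ℂ h)
    (h0 : ∀ v, h v ≠ 0) {q : V → ℝ} (hqc : Continuous q)
    (hq : ∀ (z : ℂ) v, q (z • v) = ‖z‖ ^ 2 * q v)
    (hper : ∀ v, ∀ l ∈ Λ, ‖h (v + l)‖ * Real.exp (-q (v + l)) = ‖h v‖ * Real.exp (-q v)) :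
    (∀ v, q v = 0) ∧ ∀ v, h v = h 0 := by
  have key : ∀ {f : V → ℂ} {q : V → ℝ}, Continuous f → Continuous q →
      (∀ v, ∀ l ∈ Λ, ‖f (v + l)‖ * Real.exp (-q (v + l)) = ‖f v‖ * Real.exp (-q v)) →
      ∃ C, ∀ v, ‖f v‖ ≤ C * Real.exp (q v) := by
    intro f q hf hq hp
    have hc : Continuous fun v => ‖f v‖ * Real.exp (-q v) := by fun_prop
    obtain ⟨C, hC⟩ := (IsZLattice.isCompact_range_of_periodic Λ _ hc hp).bddAbove
    refine ⟨C, fun v => ?_⟩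
    have : ‖f v‖ * Real.exp (-q v) ≤ C := hC ⟨v, rfl⟩
    rwa [Real.exp_neg, ← div_eq_mul_inv, div_le_iff₀ (Real.exp_pos _)] at this
  obtain ⟨C, hC⟩ := key hd.continuous hqc hper
  have hd' : Differentiable ℂ fun v => (h v)⁻¹ := hd.inv h0
  obtain ⟨C', hC'⟩ := key (q := fun v => -q v) hd'.continuous hqc.neg (fun v l hl => by
    have := hper v l hl
    rw [norm_inv, norm_inv, Real.exp_neg (-q _), Real.exp_neg (-q _), ← mul_inv, this, mul_inv])
  have hq0 : ∀ v, q v = 0 := fun v => by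
    have h1 := not_neg_of_norm_le_exp hd h0 hq hC v
    have h2 := not_neg_of_norm_le_exp hd' (fun v => inv_ne_zero (h0 v))
      (q := fun v => -q v) (fun z v => by rw [hq]; ring) hC' v
    simp only [not_lt, neg_nonneg] at h1 h2
    exact le_antisymm h2 h1
  refine ⟨hq0, fun v => hd.apply_eq_apply_of_bounded
    (isBounded_iff_forall_norm_le.2 ⟨C, ?_⟩) v 0⟩
  rintro _ ⟨v, rfl⟩
  simpa [hq0] using hC v

/-- The complex conjugate of an antiholomorphic function is holomorphic. -/
theorem differentiableAt_conj_of_antilinear {g : V → ℂ} {x : V} {g' : V →L[ℝ] ℂ}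
    (hg : HasFDerivAt g g' x) (hI : ∀ v, g' (I • v) = -(I * g' v)) :
    DifferentiableAt ℂ (fun v => conj (g v)) x := by
  have h1 : HasFDerivAt (fun v => conj (g v)) ((conjCLE : ℂ →L[ℝ] ℂ).comp g') x :=
    conjCLE.hasFDerivAt.comp x hg
  let L : V →L[ℂ] ℂ :=
    { toFun := fun v => conj (g' v)
      map_add' := fun v w => by simp
      map_smul' := fun c v => by
        have : c • v = c.re • v + c.im • (I • v) := by
          conv_lhs => rw [← re_add_im c, add_smul, mul_smul]
          rfl
        rw [this, map_add, map_smul, map_smul, hI]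
        simp
        linear_combination conj (g' v) * re_add_im c
      cont := continuous_conj.comp g'.continuous }
  exact (hasFDerivAt_of_restrictScalars ℝ h1
    (show L.restrictScalars ℝ = _ from rfl)).differentiableAt

/-- The composition of a holomorphic map with a continuous antilinear map is antiholomorphic. -/
theorem antiholomorphicNear_comp {E G : Type*} [NormedAddCommGroup E] [NormedSpace ℂ E]
    [NormedAddCommGroup G] [NormedSpace ℂ G] {f : E → G} (hf : Differentiable ℂ f)
    (A : V →L[ℝ] E) (hA : ∀ v, A (I • v) = -(I • A v)) (x : V) :
    AntiholomorphicNear (f ∘ A) x := by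
  refine Filter.Eventually.of_forall fun y =>
    ⟨((fderiv ℂ f (A y)).restrictScalars ℝ).comp A, ?_, fun v => ?_⟩
  · exact ((hf (A y)).hasFDerivAt.restrictScalars ℝ).comp y A.hasFDerivAt
  · simp [hA]

end Analysis

/-! ### Antiholomorphic lifts -/

section Lifts

variable {V : Type*} [NormedAddCommGroup V] [NormedSpace ℂ V] {Λ : Submodule ℤ V}

omit [NormedSpace ℂ V] in
theorem eventually_mem_lattice_imp_eq_zero (Λ : Submodule ℤ V) [DiscreteTopology Λ] :
    ∀ᶠ v in 𝓝 (0 : V), v ∈ Λ → v = 0 := by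
  obtain ⟨t, ht, hts⟩ := isOpen_induced_iff.1 (isOpen_discrete ({0} : Set Λ))
  have h0 : (0 : V) ∈ t := by
    have : (0 : Λ) ∈ ((↑) : Λ → V) ⁻¹' t := by rw [hts]; rfl
    exact this
  filter_upwards [ht.mem_nhds h0] with v hv hvΛ
  have : (⟨v, hvΛ⟩ : Λ) ∈ ((↑) : Λ → V) ⁻¹' t := hv
  rw [hts] at this
  exact congrArg Subtype.val this

namespace LatticeInvolution

variable (τ : LatticeInvolution Λ)

theorem map_I_smul (v : V) : τ.toMap (I • v) = -(I • τ.toMap v) := by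
  rw [map_smulₛₗ, conj_I, neg_smul]

/-- The antilinear involution as a continuous real linear map. -/
noncomputable def realCLM [FiniteDimensional ℂ V] : V →L[ℝ] V :=
  LinearMap.toContinuousLinearMap
    { toFun := τ.toMap
      map_add' := map_add _
      map_smul' := fun c v => by
        change τ.toMap ((c : ℂ) • v) = (c : ℂ) • τ.toMap v
        rw [map_smulₛₗ, conj_ofReal] }

@[simp] theorem realCLM_apply [FiniteDimensional ℂ V] (v : V) : τ.realCLM v = τ.toMap v := rfl

theorem continuous_toMap [FiniteDimensional ℂ V] : Continuous τ.toMap := τ.realCLM.continuous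

@[simp] theorem coe_latticeMap (l : Λ) : (τ.latticeMap l : V) = τ.toMap l := rfl

theorem coe_double (m : τ.halfAntiLattice) : (τ.double m : V) = (2 : ℂ) • (m : V) := by
  simp only [double, two_smul]

theorem map_halfAntiLattice (m : τ.halfAntiLattice) : τ.toMap m = -m := by
  have h := m.2.2
  rw [two_zsmul, map_add, ← two_smul ℂ, ← two_smul ℂ, ← smul_neg] at h
  exact smul_right_injective V (two_ne_zero (α := ℂ)) h

@[simp] theorem torusMap_mk (v : V) :
    τ.torusMap (Submodule.Quotient.mk v) = Submodule.Quotient.mk (τ.toMap v) := rfl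

end LatticeInvolution

namespace AHDatum

variable (D : AHDatum Λ)

theorem toBundle_eq_iff {p q : V × ℂ} : D.toBundle p = D.toBundle q ↔
    ∃ l : Λ, q.1 = p.1 + l ∧ q.2 = D.factor l p.1 * p.2 :=
  Quotient.eq (r := D.setoid)

theorem toBundle_mk_inj {v : V} {z w : ℂ} :
    D.toBundle (v, z) = D.toBundle (v, w) ↔ z = w := by
  refine ⟨fun h => ?_, fun h => h ▸ rfl⟩
  obtain ⟨l, h1, h2⟩ := (D.toBundle_eq_iff).1 h
  obtain rfl : l = 0 := by simpa using h1
  simpa [factor_zero] using h2.symm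

theorem toBundle_add (l : Λ) (v : V) (z : ℂ) :
    D.toBundle (v + l, D.factor l v * z) = D.toBundle (v, z) :=
  ((D.toBundle_eq_iff).2 ⟨l, rfl, rfl⟩).symm

@[simp] theorem proj_toBundle (p : V × ℂ) :
    D.proj (D.toBundle p) = Submodule.Quotient.mk p.1 := rfl

@[simp] theorem smul_toBundle (c : ℂ) (v : V) (z : ℂ) :
    c • D.toBundle (v, z) = D.toBundle (v, c * z) := rfl

@[simp] theorem zeroSection_mk (v : V) :
    D.zeroSection (Submodule.Quotient.mk v) = D.toBundle (v, 0) := rfl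

theorem exists_toBundle_of_proj {p : D.LineBundle} {v : V}
    (h : D.proj p = Submodule.Quotient.mk v) : ∃ z, p = D.toBundle (v, z) := by
  obtain ⟨⟨w, y⟩, rfl⟩ : ∃ q, D.toBundle q = p := Quotient.exists_rep p
  have h' : v - w ∈ Λ := (Submodule.Quotient.eq Λ).1 h.symm
  refine ⟨D.factor ⟨v - w, h'⟩ w * y, (D.toBundle_eq_iff).2 ⟨⟨v - w, h'⟩, by simp, rfl⟩⟩

theorem continuous_toBundle : Continuous D.toBundle := continuous_quotient_mk'

theorem norm_factor (l : Λ) (v : V) :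
    ‖D.factor l v‖ = Real.exp (Real.pi * ((D.H l v).re + 1 / 2 * (D.H l l).re)) := by
  rw [factor, norm_mul, Circle.norm_coe, one_mul, norm_exp]
  congr 1
  simp

variable [FiniteDimensional ℂ V]

theorem continuous_H : Continuous fun p : V × V => D.H p.1 p.2 := by
  let B : V →ₗ[ℝ] V →ₗ[ℝ] ℂ := LinearMap.mk₂ ℝ (fun v w => D.H v w)
    (fun v v' w => by simp)
    (fun c v w => by
      change D.H ((c : ℂ) • v) w = (c : ℂ) • D.H v w
      rw [map_smulₛₗ, conj_ofReal, LinearMap.smul_apply])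
    (fun v w w' => by simp)
    (fun c v w => by
      change D.H v ((c : ℂ) • w) = (c : ℂ) • D.H v w
      rw [map_smul])
  exact B.toContinuousBilinearMap.continuous₂

theorem differentiable_H (v : V) : Differentiable ℂ fun w => D.H v w :=
  (LinearMap.toContinuousLinearMap (D.H v)).differentiable

theorem differentiable_factor (l : Λ) : Differentiable ℂ (D.factor l) := by
  have := D.differentiable_H l
  unfold factor
  fun_prop

variable (τ : LatticeInvolution Λ)

/-- The Appell-Humbert datum is compatible with the real structure `τ`: the Hermitian form and the
semi-character become conjugate under `τ`. -/
structure IsReal : Prop where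
  H_map : ∀ v w, D.H (τ.toMap v) (τ.toMap w) = conj (D.H v w)
  α_map : ∀ l, (D.α (τ.latticeMap l) : ℂ) = conj (D.α l : ℂ)

variable {D τ}

omit [FiniteDimensional ℂ V] in
/-- If the real parts of `H` and of its transform agree on the diagonal, then `H` is compatible
with `τ`, by polarization. -/
theorem H_map_of_diagonal (h : ∀ v, (D.H (τ.toMap v) (τ.toMap v)).re = (D.H v v).re) (v w : V) :
    D.H (τ.toMap v) (τ.toMap w) = conj (D.H v w) := by
  have hre : ∀ v w, (D.H (τ.toMap v) (τ.toMap w)).re = (D.H v w).re := by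
    intro v w
    have h1 := h (v + w)
    simp only [map_add, LinearMap.add_apply, D.hermitian v w,
      D.hermitian (τ.toMap v) (τ.toMap w), add_re, conj_re, h v, h w] at h1
    linarith
  have him := hre v (I • w)
  rw [τ.map_I_smul] at him
  apply Complex.ext
  · simp [hre]
  · simpa using him

/-- A fibrewise antilinear lift of `τ` is `[v, z] ↦ [τ v, conj z * g v]` for an antiholomorphic
function `g` on the vector space. -/
theorem IsAntiLift.exists_coeff [DiscreteTopology Λ] {F : D.LineBundle → D.LineBundle}
    (hF : D.IsAntiLift τ F) :
    ∃ g : V → ℂ, (∀ v z, F (D.toBundle (v, z)) = D.toBundle (τ.toMap v, conj z * g v)) ∧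
      Differentiable ℂ fun v => conj (g v) := by
  have h1 : ∀ v, ∃ y, F (D.toBundle (v, 1)) = D.toBundle (τ.toMap v, y) := fun v =>
    D.exists_toBundle_of_proj (by rw [hF.proj_map, proj_toBundle, τ.torusMap_mk])
  choose g hg using h1
  have hgz : ∀ v z, F (D.toBundle (v, z)) = D.toBundle (τ.toMap v, conj z * g v) := fun v z => by
    rw [← smul_toBundle, ← hg, ← hF.map_smul, smul_toBundle, mul_one]
  refine ⟨g, hgz, fun v => ?_⟩
  obtain ⟨f, hf, hanti, hloc⟩ := hF.antiholomorphic (v, 1) (τ.toMap v, g v) (hg v)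
  have hc : Filter.Tendsto (fun w : V => (w, (1 : ℂ))) (𝓝 v) (𝓝 (v, 1)) :=
    (Continuous.prodMk_left (1 : ℂ)).tendsto v
  obtain ⟨f', hf', hI⟩ := hanti.self_of_nhds
  -- By discreteness of the lattice the first component of the local lift `f` is `τ` itself.
  have hcont : Filter.Tendsto (fun w => (f (w, 1)).1 - τ.toMap w) (𝓝 v) (𝓝 0) := by
    have h2 : Filter.Tendsto (fun w => (f (w, 1)).1) (𝓝 v) (𝓝 (τ.toMap v)) := by
      have := (continuous_fst.tendsto _).comp (hf'.continuousAt.tendsto.comp hc)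
      rwa [hf] at this
    simpa using h2.sub (τ.continuous_toMap.tendsto v)
  have heq : (fun w => (f (w, 1)).2) =ᶠ[𝓝 v] g := by
    filter_upwards [hcont.eventually (eventually_mem_lattice_imp_eq_zero Λ),
      hc.eventually hloc] with w hw hw'
    rw [hg] at hw'
    obtain ⟨l, e1, e2⟩ := (D.toBundle_eq_iff).1 hw'
    obtain rfl : l = 0 := by
      have : ((l : Λ) : V) = 0 := by
        have hl : (f (w, 1)).1 - τ.toMap w = l := by rw [e1]; simp
        rw [← hl]
        exact hw (hl ▸ l.2)
      exact_mod_cast this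
    simpa [factor_zero] using e2
  have hin : HasFDerivAt (fun w : V => (w, (1 : ℂ))) (ContinuousLinearMap.inl ℝ V ℂ) v :=
    hasFDerivAt_prodMk_left v (1 : ℂ)
  have hg' : HasFDerivAt g (((ContinuousLinearMap.snd ℝ V ℂ).comp f').comp
      (ContinuousLinearMap.inl ℝ V ℂ)) v := by
    refine HasFDerivAt.congr_of_eventuallyEq ?_ heq.symm
    exact HasFDerivAt.comp (g := fun p => (f p).2) v (hasFDerivAt_snd.comp _ hf') hin
  refine differentiableAt_conj_of_antilinear hg' fun w => ?_
  have := congrArg Prod.snd (hI (w, 0))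
  simpa using this

/-- An antiholomorphic lift of `τ` that is nowhere zero on the fibres forces the Appell-Humbert
datum to be compatible with `τ`, and is itself given by a constant. For `g` as in
`IsAntiLift.exists_coeff`, the function `conj ∘ g` transforms by the quotient of two canonical
factors, so `|g v| exp (-π/2 (H (τ v) (τ v) - H v v))` is periodic. -/
theorem IsAntiLift.isReal_and_const [DiscreteTopology Λ] [IsZLattice ℝ Λ]
    {F : D.LineBundle → D.LineBundle} (hF : D.IsAntiLift τ F)
    (hne : ∀ v, F (D.toBundle (v, 1)) ≠ D.toBundle (τ.toMap v, 0)) :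
    D.IsReal τ ∧ ∃ c : ℂ, c ≠ 0 ∧
      ∀ v z, F (D.toBundle (v, z)) = D.toBundle (τ.toMap v, c * conj z) := by
  obtain ⟨g, hg, hd⟩ := hF.exists_coeff
  have g0 : ∀ v, g v ≠ 0 := fun v h => hne v (by rw [hg, h, mul_zero])
  have hfun : ∀ (l : Λ) v, conj (D.factor l v) * g (v + l) =
      D.factor (τ.latticeMap l) (τ.toMap v) * g v := by
    intro l v
    have h := hg (v + l) (D.factor l v * 1)
    rw [toBundle_add, hg, map_add, map_one, one_mul, mul_one,
      ← D.toBundle_add (τ.latticeMap l), LatticeInvolution.coe_latticeMap, toBundle_mk_inj] at h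
    exact h.symm
  let q : V → ℝ := fun v => Real.pi / 2 * ((D.H (τ.toMap v) (τ.toMap v)).re - (D.H v v).re)
  have hqc : Continuous q := by
    have h1 : Continuous fun v => D.H v v :=
      D.continuous_H.comp (continuous_id.prodMk continuous_id)
    have h2 : Continuous fun v => D.H (τ.toMap v) (τ.toMap v) := h1.comp τ.continuous_toMap
    exact ((continuous_re.comp h2).sub (continuous_re.comp h1)).const_mul _
  have hq : ∀ (z : ℂ) v, q (z • v) = ‖z‖ ^ 2 * q v := by
    intro z v
    have h1 : conj z * z = ((‖z‖ ^ 2 : ℝ) : ℂ) := by rw [conj_mul']; simp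
    have h2 : z * conj z = ((‖z‖ ^ 2 : ℝ) : ℂ) := by rw [mul_comm, h1]
    simp only [q, map_smulₛₗ, LinearMap.smul_apply, smul_eq_mul, ← mul_assoc, RingHom.id_apply,
      conj_conj, h1, h2, re_ofReal_mul]
    ring
  obtain ⟨hq0, hconst⟩ := eq_zero_and_const_of_periodic Λ hd
    (fun v => (map_ne_zero _).2 (g0 v)) hqc hq (by
      intro v l hl
      have h := congrArg norm (hfun ⟨l, hl⟩ v)
      rw [norm_mul, norm_mul, norm_conj, norm_factor, norm_factor] at h
      rw [norm_conj, norm_conj]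
      simp only [LatticeInvolution.coe_latticeMap] at h
      have e : ∀ a b x y s t : ℝ, Real.exp a * x = Real.exp b * y → b + t = a + s →
          x * Real.exp (-s) = y * Real.exp (-t) := by
        intro a b x y s t h1 h2
        have h3 : Real.exp (-s) = Real.exp a * Real.exp (-(a + s)) := by
          rw [← Real.exp_add]; congr 1; ring
        have h4 : Real.exp (-t) = Real.exp b * Real.exp (-(b + t)) := by
          rw [← Real.exp_add]; congr 1; ring
        rw [h3, h4, h2]
        linear_combination Real.exp (-(a + s)) * h1
      refine e _ _ _ _ _ _ h ?_
      simp only [q, map_add, LinearMap.add_apply, D.hermitian v l,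
        D.hermitian (τ.toMap v) (τ.toMap l), add_re, conj_re]
      ring)
  have gc : ∀ v, g v = g 0 := fun v => RingHom.injective _ (hconst v)
  have hH : ∀ v w, D.H (τ.toMap v) (τ.toMap w) = conj (D.H v w) :=
    H_map_of_diagonal fun v => by
      have := hq0 v
      simp only [q, mul_eq_zero, div_eq_zero_iff, Real.pi_ne_zero, OfNat.ofNat_ne_zero, or_self,
        false_or] at this
      exact sub_eq_zero.1 this
  refine ⟨⟨hH, fun l => ?_⟩, g 0, g0 0, fun v z => by rw [hg, gc v, mul_comm]⟩
  have h := hfun l 0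
  rw [gc] at h
  have h' := mul_right_cancel₀ (g0 0) h
  simp only [factor, map_zero, zero_add, LatticeInvolution.coe_latticeMap, hH, map_mul,
    ← exp_conj, conj_ofReal, map_div₀, map_one, map_ofNat] at h'
  exact (mul_right_cancel₀ (exp_ne_zero _) h').symm

end AHDatum

end Lifts

/-! ### Real lifts -/

section RealLifts

variable {V : Type*} [NormedAddCommGroup V] [NormedSpace ℂ V] {Λ : Submodule ℤ V}

namespace AHDatum

variable {D : AHDatum Λ} {τ : LatticeInvolution Λ}

theorem IsReal.factor_map (h : D.IsReal τ) (l : Λ) (v : V) :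
    D.factor (τ.latticeMap l) (τ.toMap v) = conj (D.factor l v) := by
  simp only [factor, h.α_map, h.H_map, LatticeInvolution.coe_latticeMap, map_mul, ← exp_conj,
    map_add, conj_ofReal, map_div₀, map_one, map_ofNat]

/-- The lift `[v, z] ↦ [τ v, conj z]`, which is well defined if the Appell-Humbert datum is
compatible with `τ`. -/
def conjLift (h : D.IsReal τ) : D.LineBundle → D.LineBundle :=
  Quotient.map (fun p => (τ.toMap p.1, conj p.2)) (by
    rintro p q ⟨l, h1, h2⟩
    exact ⟨τ.latticeMap l, by simp [h1], by simp [h2, h.factor_map]⟩)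

theorem conjLift_toBundle (h : D.IsReal τ) (v : V) (z : ℂ) :
    conjLift h (D.toBundle (v, z)) = D.toBundle (τ.toMap v, conj z) := rfl

theorem isRealLift_conjLift [FiniteDimensional ℂ V] (h : D.IsReal τ) :
    D.IsRealLift τ (conjLift h) where
  proj_map := by rintro ⟨p⟩; rfl
  map_smul := by
    rintro c ⟨v, z⟩
    change D.toBundle (τ.toMap v, conj (c * z)) = D.toBundle (τ.toMap v, conj c * conj z)
    rw [map_mul]
  involutive := by
    rintro ⟨v, z⟩
    change D.toBundle (τ.toMap (τ.toMap v), conj (conj z)) = D.toBundle (v, z)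
    rw [τ.involutive, conj_conj]
  antiholomorphic := by
    rintro ⟨v, z⟩ ⟨w, y⟩ hvw
    obtain ⟨l, h1, h2⟩ := (D.toBundle_eq_iff).1 ((conjLift_toBundle h v z).symm.trans hvw)
    let A : V × ℂ →L[ℝ] V × ℂ := τ.realCLM.prodMap (conjCLE : ℂ →L[ℝ] ℂ)
    let f : V × ℂ → V × ℂ := fun p => (p.1 + l, D.factor l p.1 * p.2)
    have hf : Differentiable ℂ f :=
      (differentiable_fst.add_const _).prodMk
        (((D.differentiable_factor l).comp differentiable_fst).mul differentiable_snd)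
    refine ⟨f ∘ A, Prod.ext h1.symm h2.symm, antiholomorphicNear_comp hf A ?_ _,
      Filter.Eventually.of_forall fun p => ?_⟩
    · intro p
      ext
      · simp [A]
      · simp [A]
    · exact (D.toBundle_add l (τ.toMap p.1) (conj p.2)).symm

theorem IsInvariant.isReal [FiniteDimensional ℂ V] [DiscreteTopology Λ] [IsZLattice ℝ Λ]
    (h : D.IsInvariant τ) : D.IsReal τ := by
  obtain ⟨Φ, h1, h2, h3⟩ := h
  have hF : D.IsAntiLift τ fun p => (Φ p).1.2 :=
    ⟨fun p => by rw [(Φ p).2, h1], h2, h3⟩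
  refine (hF.isReal_and_const fun v hv => ?_).1
  have h4 : Φ (D.toBundle (v, 1)) = Φ (D.toBundle (v, 0)) := by
    refine Subtype.ext (Prod.ext ?_ ?_)
    · rw [h1, h1]; rfl
    · have h5 := h2 0 (D.toBundle (v, 1))
      change (Φ (D.toBundle (v, 1))).1.2 = _ at hv
      rw [hv, map_zero, smul_toBundle, smul_toBundle, zero_mul, zero_mul] at h5
      rw [hv, h5]
  exact one_ne_zero ((D.toBundle_mk_inj).1 (Φ.injective h4))

theorem IsRealLift.exists_const [FiniteDimensional ℂ V] [DiscreteTopology Λ] [IsZLattice ℝ Λ]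
    {F : D.LineBundle → D.LineBundle} (hF : D.IsRealLift τ F) :
    ∃ c : ℂ, ‖c‖ = 1 ∧ ∀ v z, F (D.toBundle (v, z)) = D.toBundle (τ.toMap v, c * conj z) := by
  obtain ⟨-, c, -, hc⟩ := hF.toIsAntiLift.isReal_and_const fun v hv => by
    have h := hF.involutive (D.toBundle (v, 1))
    have h0 := map_zeroSection hF (Submodule.Quotient.mk (τ.toMap v))
    simp only [zeroSection_mk, τ.torusMap_mk, τ.involutive] at h0
    rw [hv, h0, toBundle_mk_inj] at h
    exact zero_ne_one h
  refine ⟨c, ?_, hc⟩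
  have h := hF.involutive (D.toBundle (0, 1))
  rw [hc, hc, τ.involutive, toBundle_mk_inj, map_one, mul_one, mul_conj, normSq_eq_norm_sq] at h
  have h' : ‖c‖ ^ 2 = 1 := by exact_mod_cast h
  exact (pow_eq_one_iff_of_nonneg (norm_nonneg _) two_ne_zero).1 h'

/-- Over the component `V^τ + m` the fixed vectors of a real lift are the real multiples of an
explicit frame. -/
theorem IsRealLift.exists_frame [FiniteDimensional ℂ V] [DiscreteTopology Λ] [IsZLattice ℝ Λ]
    {F : D.LineBundle → D.LineBundle} (hF : D.IsRealLift τ F) (hD : D.IsReal τ)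
    (m : τ.halfAntiLattice) :
    ∃ s : ℂ, s ≠ 0 ∧ ∀ w, τ.toMap w = w → ∀ x : ℂ,
      F (D.toBundle (m + w, s * exp (Real.pi * D.H m w) * x)) =
        D.toBundle (m + w, s * exp (Real.pi * D.H m w) * x) ↔ conj x = x := by
  obtain ⟨c, hc, hFc⟩ := hF.exists_const
  have hm := τ.map_halfAntiLattice m
  set k : Λ := -τ.double m with hk
  have hkm : (k : V) = (-2 : ℂ) • (m : V) := by
    simp only [hk, Submodule.coe_neg, τ.coe_double, neg_smul]
  obtain ⟨s, hs⟩ := IsAlgClosed.exists_eq_mul_self (c * conj (D.α k : ℂ))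
  have hα : (D.α k : ℂ) * conj (D.α k : ℂ) = 1 := by rw [mul_conj, Circle.normSq_coe, ofReal_one]
  have hs1 : ‖s‖ = 1 := by
    have h := congrArg norm hs
    rw [norm_mul, norm_mul, norm_conj, Circle.norm_coe, hc, mul_one] at h
    nlinarith [norm_nonneg s]
  have hs0 : s ≠ 0 := norm_ne_zero_iff.1 (by rw [hs1]; exact one_ne_zero)
  have hss : s * conj s = 1 := by rw [mul_conj, normSq_eq_norm_sq, hs1]; simp
  refine ⟨s, hs0, fun w hw x => ?_⟩
  have hmw : conj (D.H m w) = -D.H m w := by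
    rw [← hD.H_map, hm, hw, map_neg, LinearMap.neg_apply]
  have hfac : D.factor k (m + w) = D.α k * (exp (-(Real.pi * D.H m w)) *
      exp (-(Real.pi * D.H m w))) := by
    rw [factor, hkm, ← exp_add]
    congr 2
    simp only [map_smulₛₗ, LinearMap.smul_apply, map_add, smul_eq_mul, map_neg, map_ofNat]
    ring
  have hE : exp (-(Real.pi * D.H m w)) * exp (Real.pi * D.H m w) = 1 := by
    rw [← exp_add, neg_add_cancel, exp_zero]
  have hτ : τ.toMap (m + w) = m + w + k := by
    rw [map_add, hm, hw, hkm]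
    module
  have hcE : conj (exp (Real.pi * D.H m w)) = exp (-(Real.pi * D.H m w)) := by
    rw [← exp_conj, map_mul, conj_ofReal, hmw, mul_neg]
  rw [hFc, hτ, ← D.toBundle_add k (m + w) (s * _ * x), toBundle_mk_inj, hfac, map_mul, map_mul, hcE]
  -- Both sides are the same nonzero multiple of `conj x` and of `x`.
  have hcs : c * conj s = D.α k * s := by
    linear_combination (-(c * conj s)) * hα + D.α k * conj s * hs + D.α k * s * hss
  have key : (D.α k : ℂ) * s * exp (-(Real.pi * D.H m w)) ≠ 0 :=
    mul_ne_zero (mul_ne_zero (Circle.coe_ne_zero _) hs0) (exp_ne_zero _)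
  have e1 : c * (conj s * exp (-(Real.pi * D.H m w)) * conj x) =
      D.α k * s * exp (-(Real.pi * D.H m w)) * conj x := by
    linear_combination exp (-(Real.pi * D.H m w)) * conj x * hcs
  have e2 : D.α k * (exp (-(Real.pi * D.H m w)) * exp (-(Real.pi * D.H m w))) *
      (s * exp (Real.pi * D.H m w) * x) = D.α k * s * exp (-(Real.pi * D.H m w)) * x := by
    linear_combination D.α k * exp (-(Real.pi * D.H m w)) * s * x * hE
  rw [e1, e2, mul_right_inj' key]

end AHDatum

end RealLifts

/-! ### Continuity of fibre coordinates -/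

section Coordinates

variable {V : Type*} [NormedAddCommGroup V] [NormedSpace ℂ V] [FiniteDimensional ℂ V]
  {Λ : Submodule ℤ V}

namespace AHDatum

variable (D : AHDatum Λ)

theorem isOpenMap_toBundle : IsOpenMap D.toBundle := by
  intro U hU
  change IsOpen (D.toBundle ⁻¹' (D.toBundle '' U))
  have : D.toBundle ⁻¹' (D.toBundle '' U) =
      ⋃ l : Λ, (fun p : V × ℂ => (p.1 + (l : V), D.factor l p.1 * p.2)) ⁻¹' U := by
    ext p
    simp only [Set.mem_preimage, Set.mem_image, Set.mem_iUnion]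
    constructor
    · rintro ⟨q, hq, h⟩
      obtain ⟨l, h1, h2⟩ := (D.toBundle_eq_iff).1 h.symm
      exact ⟨l, by rwa [← h1, ← h2]⟩
    · rintro ⟨l, hl⟩
      exact ⟨_, hl, D.toBundle_add l p.1 p.2⟩
  rw [this]
  refine isOpen_iUnion fun l => hU.preimage ?_
  have := (D.differentiable_factor l).continuous
  fun_prop

/-- The quotient map onto the line bundle is open and injective on small sets, so the fibre
coordinate of a continuous map along a continuous lift of its base point is continuous. -/
theorem continuous_coordinate [DiscreteTopology Λ] {X : Type*} [TopologicalSpace X] {δ : X → V}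
    {ζ : X → ℂ} (hδ : Continuous δ) (hs : Continuous fun t => D.toBundle (δ t, ζ t)) :
    Continuous ζ := by
  refine continuous_iff_continuousAt.2 fun t₀ W hW => ?_
  have hsub : Filter.Tendsto (fun p : V × V => p.1 - p.2) (𝓝 (δ t₀, δ t₀)) (𝓝 0) := by
    rw [← sub_self (δ t₀)]
    exact (continuous_fst.sub continuous_snd).tendsto (δ t₀, δ t₀)
  obtain ⟨U, hU, hU'⟩ := Filter.eventually_prod_self_iff
    (r := fun v w : V => v - w ∈ Λ → v - w = 0) |>.1
    ((nhds_prod_eq (x := δ t₀) (y := δ t₀)) ▸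
      hsub.eventually (eventually_mem_lattice_imp_eq_zero Λ))
  have himg := D.isOpenMap_toBundle.image_mem_nhds (prod_mem_nhds hU hW)
  change ∀ᶠ t in 𝓝 t₀, ζ t ∈ W
  filter_upwards [hs.continuousAt.eventually_mem himg,
    hδ.continuousAt.eventually_mem hU] with t ht htU
  obtain ⟨⟨v, z⟩, ⟨hv, hz⟩, h⟩ := ht
  obtain ⟨l, h1, h2⟩ := (D.toBundle_eq_iff).1 h
  have hl : δ t - v = l := sub_eq_iff_eq_add'.2 h1
  obtain rfl : l = 0 := by
    have : (l : V) = 0 := by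
      rw [← hl]
      exact hU' _ htU _ hv (hl ▸ l.2)
    exact_mod_cast this
  have : ζ t = z := by simpa [factor_zero] using h2
  exact this ▸ hz

end AHDatum

end Coordinates

/-! ### Signs and the candidate for the Stiefel-Whitney map -/

section Signs

theorem neg_one_pow_val_one : (-1 : ℂ) ^ (1 : ZMod 2).val = -1 := by
  have : (1 : ZMod 2).val = 1 := rfl
  rw [this, pow_one]

theorem neg_one_pow_val_add (x y : ZMod 2) :
    (-1 : ℂ) ^ (x + y).val = (-1) ^ x.val * (-1) ^ y.val := by
  rw [ZMod.val_add, ← neg_one_pow_eq_pow_mod_two, pow_add]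

theorem neg_one_pow_val_injective :
    Function.Injective fun x : ZMod 2 => (-1 : ℂ) ^ x.val := by
  have h : ∀ x : ZMod 2, x = 0 ∨ x = 1 := by decide
  intro x y hxy
  have h1 : (1 : ℂ) ≠ -1 := by norm_num
  rcases h x with rfl | rfl <;> rcases h y with rfl | rfl <;>
    simp_all [neg_one_pow_val_one, h1.symm]

theorem exp_pi_mul_I_mul_intCast (n : ℤ) :
    exp (Real.pi * I * ((n : ℝ) : ℂ)) = (-1) ^ ((n : ZMod 2)).val := by
  rcases Int.even_or_odd' n with ⟨k, rfl | rfl⟩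
  · have h2 : (2 : ZMod 2) = 0 := rfl
    have : (Real.pi * I * (((2 * k : ℤ) : ℝ) : ℂ)) = k * (2 * Real.pi * I) := by push_cast; ring
    rw [this, exp_int_mul_two_pi_mul_I]
    simp [h2]
  · have h2 : (2 : ZMod 2) = 0 := rfl
    have : (Real.pi * I * (((2 * k + 1 : ℤ) : ℝ) : ℂ)) = k * (2 * Real.pi * I) + Real.pi * I := by
      push_cast; ring
    rw [this, exp_add, exp_int_mul_two_pi_mul_I, exp_pi_mul_I]
    simp [h2, neg_one_pow_val_one]

end Signs

section RealData

variable {V : Type*} [NormedAddCommGroup V] [NormedSpace ℂ V] {Λ : Submodule ℤ V}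

namespace AHDatum

variable {D : AHDatum Λ} {τ : LatticeInvolution Λ}

theorem imHModTwo_apply (l m : Λ) : D.imHModTwo l m = ((D.imH l m : ℤ) : ZMod 2) := rfl

theorem imH_eq_of_cast {l m : Λ} {n : ℤ} (h : (D.H l m).im = n) : D.imH l m = n := by
  have := D.cast_imH l m
  rw [h] at this
  exact_mod_cast this

theorem IsReal.H_fixed (h : D.IsReal τ) {v w : V} (hv : τ.toMap v = v) (hw : τ.toMap w = w) :
    (D.H v w).im = 0 := by
  have := h.H_map v w
  rw [hv, hw] at this
  exact conj_eq_iff_im.1 this.symm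

theorem IsReal.α_fixed (h : D.IsReal τ) (l : τ.fixedLattice) :
    conj (D.α (τ.inclusion l) : ℂ) = D.α (τ.inclusion l) := by
  rw [← h.α_map]
  congr 2
  exact Subtype.ext l.2.2

theorem IsReal.α_eq_one_or (h : D.IsReal τ) (l : τ.fixedLattice) :
    (D.α (τ.inclusion l) : ℂ) = 1 ∨ (D.α (τ.inclusion l) : ℂ) = -1 := by
  have h1 := mul_conj (D.α (τ.inclusion l) : ℂ)
  rw [h.α_fixed, Circle.normSq_coe, ofReal_one] at h1
  exact mul_self_eq_one_iff.1 h1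

open Classical in
theorem IsReal.neg_one_pow_ite (h : D.IsReal τ) (l : τ.fixedLattice) :
    (-1 : ℂ) ^ (if (D.α (τ.inclusion l) : ℂ) = 1 then (0 : ZMod 2) else 1).val =
      D.α (τ.inclusion l) := by
  have h0 : (-1 : ℂ) ≠ 1 := by norm_num
  rcases h.α_eq_one_or l with h1 | h1
  · simp [h1]
  · rw [h1, if_neg h0, neg_one_pow_val_one]

open Classical in
/-- The restriction of the semi-character to the invariant lattice vectors, a homomorphism to
`{1, -1}`, in additive notation. -/
noncomputable def IsReal.sign (h : D.IsReal τ) : τ.fixedLattice →+ ZMod 2 :=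
  AddMonoidHom.mk' (fun l => if (D.α (τ.inclusion l) : ℂ) = 1 then 0 else 1) fun a b => by
    refine neg_one_pow_val_injective ?_
    dsimp only
    rw [neg_one_pow_val_add, h.neg_one_pow_ite, h.neg_one_pow_ite, h.neg_one_pow_ite, map_add,
      D.semichar]
    have : (D.H (τ.inclusion a) (τ.inclusion b)).im = 0 := h.H_fixed a.2.2 b.2.2
    simp [this]

theorem IsReal.neg_one_pow_sign (h : D.IsReal τ) (l : τ.fixedLattice) :
    (-1 : ℂ) ^ (h.sign l).val = D.α (τ.inclusion l) :=
  h.neg_one_pow_ite l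

/-- The homomorphism `[μ] ↦ im H(2μ, ·)` mod 2 on the group of components. It is well defined since
`im H(λ - τλ, l) = 2 im H(λ, l)` for invariant `l`. -/
noncomputable def IsReal.shift (h : D.IsReal τ) :
    τ.ComponentGroup →+ (τ.fixedLattice →+ ZMod 2) :=
  QuotientAddGroup.lift _
    (AddMonoidHom.mk' (fun m : τ.halfAntiLattice => (D.imHModTwo (τ.double m)).comp τ.inclusion)
      fun a b => by
        ext l
        simp only [AddMonoidHom.comp_apply, AddMonoidHom.add_apply, imHModTwo_apply]
        rw [← Int.cast_add]
        congr 1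
        refine imH_eq_of_cast ?_
        push_cast
        rw [cast_imH, cast_imH]
        simp [LatticeInvolution.double]) fun a ha => by
    obtain ⟨l, hl, hal⟩ := AddSubgroup.mem_addSubgroupOf.1 ha
    ext k
    change ((D.imH _ _ : ℤ) : ZMod 2) = 0
    have : D.imH (τ.double a) (τ.inclusion k) = 2 * D.imH ⟨l, hl⟩ (τ.inclusion k) := by
      refine imH_eq_of_cast ?_
      push_cast
      rw [cast_imH]
      have h1 : ((τ.double a : Λ) : V) = l - τ.toMap l := by
        simp only [LatticeInvolution.double, hal, ← Int.cast_smul_eq_zsmul ℂ, smul_smul]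
        norm_num
      have h2 := h.H_map l k
      rw [k.2.2] at h2
      rw [h1, map_sub, LinearMap.sub_apply]
      change ((D.H l) k - (D.H (τ.toMap l)) k).im = 2 * (D.H l k).im
      rw [h2, sub_im, conj_im]
      ring
    have h2 : (2 : ZMod 2) = 0 := rfl
    rw [this, Int.cast_mul, Int.cast_ofNat, h2, zero_mul]

theorem IsReal.shift_mk (h : D.IsReal τ) (m : τ.halfAntiLattice) :
    h.shift (QuotientAddGroup.mk m) = (D.imHModTwo (τ.double m)).comp τ.inclusion := rfl

/-- The Stiefel-Whitney map in terms of the Appell-Humbert datum. -/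
noncomputable def IsReal.whitney (h : D.IsReal τ) (x : τ.ComponentGroup) :
    τ.fixedLattice →+ ZMod 2 :=
  h.sign + h.shift x

theorem IsReal.neg_one_pow_whitney (h : D.IsReal τ) (m : τ.halfAntiLattice) (l : τ.fixedLattice) :
    (-1 : ℂ) ^ (h.whitney (QuotientAddGroup.mk m) l).val =
      D.α (τ.inclusion l) * exp (2 * Real.pi * I * ((D.H m l).im : ℂ)) := by
  rw [whitney, AddMonoidHom.add_apply, neg_one_pow_val_add, h.neg_one_pow_sign, shift_mk]
  congr 1
  rw [AddMonoidHom.comp_apply, imHModTwo_apply, ← exp_pi_mul_I_mul_intCast, cast_imH]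
  congr 1
  simp only [LatticeInvolution.double, two_zsmul, map_add, LinearMap.add_apply, add_im]
  push_cast
  change _ * (((D.H m l).im : ℂ) + ((D.H m l).im : ℂ)) = _
  ring

theorem IsReal.whitney_trace (h : D.IsReal τ) (m : τ.halfAntiLattice) (l : Λ) :
    h.whitney (QuotientAddGroup.mk m) (τ.trace l) = (D.imH l (τ.latticeMap l) : ZMod 2) := by
  refine neg_one_pow_val_injective ?_
  dsimp only
  have h1 : (D.H m (τ.latticeMap l)).im = (D.H m l).im := by
    have := h.H_map m l
    rw [τ.map_halfAntiLattice, map_neg, LinearMap.neg_apply] at this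
    have := congrArg im this
    rw [neg_im, conj_im] at this
    exact neg_inj.1 this
  have h2 : 2 * Real.pi * I * ((D.H m (τ.trace l)).im : ℂ) =
      D.imH (τ.double m) l * (2 * Real.pi * I) := by
    have h3 : ((D.imH (τ.double m) l : ℤ) : ℂ) = (((D.H (τ.double m) l).im : ℝ) : ℂ) := by
      rw [← cast_imH]
      norm_cast
    have h4 : (D.H m (τ.trace l)).im = (D.H (τ.double m) l).im := by
      change (D.H m (l + τ.latticeMap l)).im = _
      rw [τ.coe_double, map_add, add_im, h1]
      simp [two_mul]
    rw [h3, h4]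
    ring
  have h5 : τ.inclusion (τ.trace l) = l + τ.latticeMap l := rfl
  rw [h.neg_one_pow_whitney, ← exp_pi_mul_I_mul_intCast, cast_imH, h2, exp_int_mul_two_pi_mul_I,
    mul_one, h5, D.semichar, h.α_map, mul_conj, Circle.normSq_coe, ofReal_one, one_mul]

end AHDatum

end RealData

/-! ### Evaluation on loops -/

section Loops

variable {V : Type*} [NormedAddCommGroup V] [NormedSpace ℂ V] {Λ : Submodule ℤ V}

theorem exists_mem_Ico_coe (t : UnitAddCircle) :
    ∃ x ∈ Set.Ico (0 : ℝ) 1, (x : UnitAddCircle) = t := by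
  have h : t ∈ ((↑) : ℝ → UnitAddCircle) '' Set.Ico 0 (0 + 1) := by
    rw [AddCircle.coe_image_Ico_eq]; trivial
  rwa [zero_add] at h

namespace AHDatum

variable {D : AHDatum Λ} {τ : LatticeInvolution Λ}

/-- The factor of automorphy relates the frame of `IsRealLift.exists_frame` at the two ends of a
path of class `l` by the sign of the Stiefel-Whitney class, up to a positive factor. -/
theorem IsReal.exists_factor_mul (h : D.IsReal τ) (m : τ.halfAntiLattice) (l : τ.fixedLattice)
    {w : V} (hw : τ.toMap w = w) :
    ∃ r : ℝ, D.factor (τ.inclusion l) (m + w) * exp (Real.pi * D.H m w) =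
      (-1) ^ (h.whitney (QuotientAddGroup.mk m) l).val * Real.exp r *
        exp (Real.pi * D.H m (w + l)) := by
  have h1 : D.H l m = conj (D.H m l) := D.hermitian m l
  have h2 : ((D.H l w).re : ℂ) = D.H l w := by
    rw [← conj_eq_iff_re, conj_eq_iff_im]
    exact h.H_fixed l.2.2 hw
  have h3 : ((D.H l l).re : ℂ) = D.H l l := by
    rw [← conj_eq_iff_re, conj_eq_iff_im]
    exact h.H_fixed l.2.2 l.2.2
  refine ⟨Real.pi * ((D.H l w).re + 1 / 2 * (D.H l l).re), ?_⟩
  have h4 : conj (D.H m l) = -D.H m l := by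
    rw [← h.H_map, τ.map_halfAntiLattice, l.2.2, map_neg, LinearMap.neg_apply]
  have h5 : I * ((D.H m l).im : ℂ) = D.H m l := by
    have h6 : (D.H m l).re = 0 := by
      have := congrArg re h4
      rw [conj_re, neg_re] at this
      linarith
    conv_rhs => rw [← re_add_im (D.H m l), h6]
    simp [mul_comm]
  have h6 : (-1 : ℂ) ^ (h.whitney (QuotientAddGroup.mk m) l).val =
      D.α (τ.inclusion l) * exp (-(2 * Real.pi * D.H m l)) := by
    have := congrArg conj (h.neg_one_pow_whitney m l)
    rw [mul_assoc _ I, h5, map_pow, map_neg, map_one, map_mul, h.α_fixed, ← exp_conj] at this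
    rw [this, map_mul, map_mul, conj_ofReal, h4, map_ofNat, mul_neg]
  have h7 : ((τ.inclusion l : Λ) : V) = l := rfl
  rw [h6, factor, h7, mul_assoc, mul_assoc, mul_assoc, ofReal_exp, ← exp_add, ← exp_add, ← exp_add]
  congr 2
  push_cast
  rw [h2, h3, map_add, map_add, h1, h4]
  ring

/-- A path in `V^τ + m` from which a loop in the component of `[m]` is obtained, extended to the
real line. -/
theorem exists_real_path {γ : C(UnitAddCircle, τ.FixedLocus)} {m : τ.halfAntiLattice}
    {l : τ.fixedLattice} (h : τ.Represents γ m l) :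
    ∃ w : ℝ → V, Continuous w ∧ (∀ t, τ.toMap (w t) = w t) ∧ w 1 = w 0 + l ∧
      ∀ t ∈ Set.Icc (0 : ℝ) 1, (γ (t : UnitAddCircle)).1 = Submodule.Quotient.mk (m + w t) := by
  obtain ⟨δ, h1, h2, h3⟩ := h
  refine ⟨fun t => Set.IccExtend zero_le_one δ t - m, ?_, fun t => h1 _, ?_, fun t ht => ?_⟩
  · exact (δ.continuous.Icc_extend' (h := zero_le_one)).sub continuous_const
  · simp only [Set.IccExtend_right, Set.IccExtend_left]
    have : δ ⟨1, Set.right_mem_Icc.2 zero_le_one⟩ = δ ⟨0, Set.left_mem_Icc.2 zero_le_one⟩ + l := h2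
    rw [this]
    abel
  · have h4 : (m : V) + (Set.IccExtend zero_le_one δ t - m) = δ ⟨t, ht⟩ := by
      rw [Set.IccExtend_of_mem _ _ ht, add_sub_cancel]
    exact (h3 ⟨t, ht⟩).trans (congrArg _ h4.symm)

variable [FiniteDimensional ℂ V] [DiscreteTopology Λ] [IsZLattice ℝ Λ]

/-- If the sign is trivial, rescaling the frame by a positive function makes it close up to a
nowhere vanishing section over the loop. -/
theorem IsRealLift.exists_section {F : D.LineBundle → D.LineBundle} (hF : D.IsRealLift τ F)
    (hD : D.IsReal τ) {γ : C(UnitAddCircle, τ.FixedLocus)} {m : τ.halfAntiLattice}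
    {l : τ.fixedLattice} (h : τ.Represents γ m l)
    (hw : hD.whitney (QuotientAddGroup.mk m) l = 0) :
    ∃ s : C(UnitAddCircle, FixedBundle F), ∀ t, fixedProj hF (s t) = γ t ∧
      s t ≠ fixedZero hF (γ t) := by
  obtain ⟨w, wc, wτ, w1, hγ⟩ := exists_real_path h
  obtain ⟨s, s0, hs⟩ := hF.exists_frame hD m
  obtain ⟨r, hr⟩ := hD.exists_factor_mul m l (wτ 0)
  rw [hw, ZMod.val_zero, pow_zero, one_mul, ← w1] at hr
  let y : ℝ → ℂ := fun t => s * exp (Real.pi * D.H m (w t)) * (Real.exp (t * r) : ℂ)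
  have y0 : ∀ t, y t ≠ 0 := fun t =>
    mul_ne_zero (mul_ne_zero s0 (exp_ne_zero _)) (ofReal_ne_zero.2 (Real.exp_ne_zero _))
  let f : ℝ → FixedBundle F := fun t =>
    ⟨D.toBundle (m + w t, y t), (hs (w t) (wτ t) _).2 (conj_ofReal _)⟩
  have hf01 : f 0 = f 1 := by
    refine Subtype.ext ?_
    change D.toBundle (m + w 0, y 0) = D.toBundle (m + w 1, y 1)
    rw [← D.toBundle_add (τ.inclusion l), w1, ← add_assoc]
    change D.toBundle (m + w 0 + l, _) = _
    congr 2
    simp only [y, zero_mul, Real.exp_zero, ofReal_one, mul_one, one_mul]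
    linear_combination s * hr
  have hy : Continuous y := by
    have := (D.differentiable_H m).continuous
    fun_prop
  have hf : Continuous f := Continuous.subtype_mk
    (D.continuous_toBundle.comp ((continuous_const.add wc).prodMk hy)) _
  refine ⟨⟨AddCircle.liftIco 1 0 f, AddCircle.liftIco_zero_continuous hf01 hf.continuousOn⟩,
    fun t => ?_⟩
  obtain ⟨x, hx, rfl⟩ := exists_mem_Ico_coe t
  have hfx : AddCircle.liftIco 1 0 f (x : UnitAddCircle) = f x :=
    AddCircle.liftIco_zero_coe_apply hx
  have hγx := hγ x ⟨hx.1, hx.2.le⟩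
  change fixedProj hF (AddCircle.liftIco 1 0 f (x : UnitAddCircle)) = _ ∧
    AddCircle.liftIco 1 0 f (x : UnitAddCircle) ≠ _
  rw [hfx]
  refine ⟨Subtype.ext hγx.symm, fun hz => y0 x ?_⟩
  have hz' : D.toBundle (m + w x, y x) = D.zeroSection (γ x).1 := congrArg Subtype.val hz
  rwa [hγx, zeroSection_mk, toBundle_mk_inj] at hz'

/-- Relative to the frame, a section over the loop would be a nowhere vanishing continuous real
function on the unit interval which changes sign. -/
theorem IsRealLift.not_exists_section {F : D.LineBundle → D.LineBundle} (hF : D.IsRealLift τ F)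
    (hD : D.IsReal τ) {γ : C(UnitAddCircle, τ.FixedLocus)} {m : τ.halfAntiLattice}
    {l : τ.fixedLattice} (h : τ.Represents γ m l)
    (hw : hD.whitney (QuotientAddGroup.mk m) l = 1) :
    ¬ ∃ s : C(UnitAddCircle, FixedBundle F), ∀ t, fixedProj hF (s t) = γ t ∧
      s t ≠ fixedZero hF (γ t) := by
  rintro ⟨S, hS⟩
  obtain ⟨w, wc, wτ, w1, hγ⟩ := exists_real_path h
  obtain ⟨s, s0, hs⟩ := hF.exists_frame hD m
  obtain ⟨r, hr⟩ := hD.exists_factor_mul m l (wτ 0)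
  rw [hw, neg_one_pow_val_one, ← w1] at hr
  let e : unitInterval → ℂ := fun t => s * exp (Real.pi * D.H m (w t))
  have e0 : ∀ t, e t ≠ 0 := fun t => mul_ne_zero s0 (exp_ne_zero _)
  have hy : ∀ t : unitInterval, ∃ y, (S ((t : ℝ) : UnitAddCircle)).1 =
      D.toBundle (m + w t, y) := fun t =>
    D.exists_toBundle_of_proj
      ((congrArg Subtype.val (hS ((t : ℝ) : UnitAddCircle)).1).trans (hγ t t.2))
  choose y hy using hy
  have hwc : Continuous fun t : unitInterval => w t := wc.comp continuous_subtype_val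
  have hyc : Continuous y := by
    refine D.continuous_coordinate (δ := fun t : unitInterval => m + w t)
      (continuous_const.add hwc) ?_
    simp only [← hy]
    exact continuous_subtype_val.comp
      (S.continuous.comp ((AddCircle.continuous_mk' 1).comp continuous_subtype_val))
  have hec : Continuous e := by
    have := (D.differentiable_H m).continuous
    fun_prop
  -- The coordinate of the section with respect to the frame.
  let x : unitInterval → ℂ := fun t => y t / e t
  have hxc : Continuous x := hyc.div hec e0
  have hey : ∀ t, e t * x t = y t := fun t => mul_div_cancel₀ _ (e0 t)
  have hx : ∀ t, ((x t).re : ℂ) = x t := fun t => by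
    rw [← conj_eq_iff_re]
    refine (hs (w t) (wτ t) (x t)).1 ?_
    change F (D.toBundle (m + w t, e t * x t)) = D.toBundle (m + w t, e t * x t)
    rw [hey, ← hy]
    exact (S _).2
  have hx0 : ∀ t, (x t).re ≠ 0 := fun t h0 => by
    have hyt : y t = 0 := by rw [← hey, ← hx, h0, ofReal_zero, mul_zero]
    refine (hS ((t : ℝ) : UnitAddCircle)).2 (Subtype.ext ?_)
    change _ = D.zeroSection _
    rw [hy, hγ t t.2, zeroSection_mk, hyt]
  have hend : (x 1).re = -(Real.exp r * (x 0).re) := by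
    have h01 : (((1 : unitInterval) : ℝ) : UnitAddCircle) = ((0 : unitInterval) : ℝ) := by
      simp
    have h1 := hy 1
    rw [h01, hy 0, ← D.toBundle_add (τ.inclusion l)] at h1
    change D.toBundle (m + w 0 + l, _) = D.toBundle (m + w 1, _) at h1
    rw [w1, ← add_assoc, toBundle_mk_inj, ← hey, ← hey] at h1
    have h2 : e 1 * x 1 = e 1 * -(Real.exp r * x 0) := by
      rw [← h1]
      change _ * (s * exp (Real.pi * D.H m (w 0)) * x 0) =
        s * exp (Real.pi * D.H m (w 1)) * _
      linear_combination s * x 0 * hr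
    have h3 := congrArg re (mul_left_cancel₀ (e0 1) h2)
    rwa [neg_re, re_ofReal_mul] at h3
  have hre : Continuous fun t => (x t).re := continuous_re.comp hxc
  have hzero : (0 : ℝ) ∈ Set.range fun t => (x t).re := by
    have hpos := Real.exp_pos r
    rcases le_total (x 0).re 0 with h0 | h0
    · exact mem_range_of_exists_le_of_exists_ge hre ⟨0, h0⟩ ⟨1, by rw [hend]; nlinarith⟩
    · exact mem_range_of_exists_le_of_exists_ge hre ⟨1, by rw [hend]; nlinarith⟩ ⟨0, h0⟩
  obtain ⟨t, ht⟩ := hzero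
  exact hx0 t ht

theorem IsRealLift.stiefelWhitneyOne_eq {F : D.LineBundle → D.LineBundle}
    (hF : D.IsRealLift τ F) (hD : D.IsReal τ) {γ : C(UnitAddCircle, τ.FixedLocus)}
    {m : τ.halfAntiLattice} {l : τ.fixedLattice} (h : τ.Represents γ m l) :
    stiefelWhitneyOne (fixedProj hF) (fixedZero hF) γ =
      hD.whitney (QuotientAddGroup.mk m) l := by
  have h01 : ∀ x : ZMod 2, x = 0 ∨ x = 1 := by decide
  unfold stiefelWhitneyOne
  rcases h01 (hD.whitney (QuotientAddGroup.mk m) l) with hw | hw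
  · rw [if_pos (hF.exists_section hD h hw), hw]
  · rw [if_neg (hF.not_exists_section hD h hw), hw]

omit [FiniteDimensional ℂ V] [DiscreteTopology Λ] [IsZLattice ℝ Λ] in
/-- The loop `t ↦ [m + t l]` has class `l`. -/
theorem exists_represents (m : τ.halfAntiLattice) (l : τ.fixedLattice) :
    ∃ γ : C(UnitAddCircle, τ.FixedLocus), τ.Represents γ m l := by
  have hl : ∀ t : ℝ, τ.toMap ((t : ℂ) • (l : V)) = (t : ℂ) • (l : V) := fun t => by
    rw [map_smulₛₗ, conj_ofReal, l.2.2]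
  let δ : ℝ → V := fun t => m + (t : ℂ) • (l : V)
  have hδ : Continuous δ := by fun_prop
  have hfix : ∀ t, τ.torusMap (Submodule.Quotient.mk (δ t)) = Submodule.Quotient.mk (δ t) := by
    intro t
    rw [τ.torusMap_mk, eq_comm, Submodule.Quotient.eq, map_add, hl, τ.map_halfAntiLattice]
    have : δ t - (-m + (t : ℂ) • (l : V)) = (2 : ℤ) • (m : V) := by
      simp only [δ, two_zsmul]; abel
    exact this ▸ m.2.1
  let f : ℝ → τ.FixedLocus := fun t => ⟨Submodule.Quotient.mk (δ t), hfix t⟩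
  have hf : Continuous f := Continuous.subtype_mk (continuous_quotient_mk'.comp hδ) _
  have hf01 : f 0 = f 1 := by
    refine Subtype.ext ((Submodule.Quotient.eq Λ).2 ?_)
    have : δ 0 - δ 1 = -l := by simp [δ]
    exact this ▸ Λ.neg_mem l.2.1
  refine ⟨⟨AddCircle.liftIco 1 0 f, AddCircle.liftIco_zero_continuous hf01 hf.continuousOn⟩,
    ⟨fun t => δ t, hδ.comp continuous_subtype_val⟩, fun t => ?_, ?_, fun t => ?_⟩
  · simpa [δ] using hl t
  · simp [δ]
  · change (AddCircle.liftIco 1 0 f ((t : ℝ) : UnitAddCircle)).1 = (f t).1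
    congr 1
    rcases t.2.2.lt_or_eq with ht | ht
    · exact AddCircle.liftIco_zero_coe_apply ⟨t.2.1, ht⟩
    · have h1 : ((t : ℝ) : UnitAddCircle) = ((0 : ℝ) : UnitAddCircle) := by
        rw [ht]; simp
      rw [h1, AddCircle.liftIco_zero_coe_apply ⟨le_rfl, zero_lt_one⟩, hf01, ht]

theorem IsReal.isStiefelWhitneyMap (hD : D.IsReal τ) : D.IsStiefelWhitneyMap τ hD.whitney :=
  ⟨⟨_, isRealLift_conjLift hD⟩, fun _ hF _ _ _ h => hF.stiefelWhitneyOne_eq hD h⟩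

theorem IsStiefelWhitneyMap.eq_whitney {w : τ.ComponentGroup → (τ.fixedLattice →+ ZMod 2)}
    (h : D.IsStiefelWhitneyMap τ w) (hD : D.IsReal τ) : w = hD.whitney := by
  obtain ⟨⟨F, hF⟩, hw⟩ := h
  funext x
  obtain ⟨m, rfl⟩ := QuotientAddGroup.mk_surjective x
  ext l
  obtain ⟨γ, hγ⟩ := exists_represents m l
  rw [← hw F hF m l γ hγ, hF.stiefelWhitneyOne_eq hD hγ]

end AHDatum

end Loops

/-! ### The Stiefel-Whitney map -/

theorem theorem8 {V : Type*} [NormedAddCommGroup V] [NormedSpace ℂ V] [FiniteDimensional ℂ V]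
    (Λ : Submodule ℤ V) [DiscreteTopology Λ] [IsZLattice ℝ Λ]
    (τ : LatticeInvolution Λ) (D : AHDatum Λ) (hinv : D.IsInvariant τ) :
    (∃! w : τ.ComponentGroup → (τ.fixedLattice →+ ZMod 2), D.IsStiefelWhitneyMap τ w) ∧
    ∀ w : τ.ComponentGroup → (τ.fixedLattice →+ ZMod 2), D.IsStiefelWhitneyMap τ w →
      (∀ m : τ.halfAntiLattice,
        w (QuotientAddGroup.mk m) = w 0 + (D.imHModTwo (τ.double m)).comp τ.inclusion) ∧
      (∀ (m : τ.halfAntiLattice) (l : Λ),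
        w (QuotientAddGroup.mk m) (τ.trace l) = (D.imH l (τ.latticeMap l) : ZMod 2)) ∧
      (∀ l : τ.fixedLattice,
        (-1 : ℂ) ^ (w 0 l).val = (starRingEnd ℂ) (D.α (τ.inclusion l) : ℂ)) := by
  have hD : D.IsReal τ := hinv.isReal
  refine ⟨⟨hD.whitney, hD.isStiefelWhitneyMap, fun w hw => hw.eq_whitney hD⟩, fun w hw => ?_⟩
  rw [hw.eq_whitney hD]
  have h0 : hD.whitney 0 = hD.sign := by rw [AHDatum.IsReal.whitney, map_zero, add_zero]
  refine ⟨fun m => ?_, hD.whitney_trace, fun l => ?_⟩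
  · rw [h0, AHDatum.IsReal.whitney, hD.shift_mk]
  · rw [h0, hD.neg_one_pow_sign, hD.α_fixed]
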